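/- An arborescence is a finite directed graph with vertex set $V$ and a distinguished root $\mathsf r$ such that from every vertex $v$ there is exactly one directed path to $\mathsf r$; let $v^\downarrow$ be the set of vertices on that path. Let $L$ be the set of leaves, i.e. of vertices without incoming edges. Give every vertex $v$ a threshold $T_v\in\mathbb N$, and let $\Omega=\{(t_v)_{v\in V}\mid 0\le t_v\le T_v\}$ be the set of configurations of grains. For $\ell\in L$, the source operator $\sigma_\ell:\Omega\to\Omega$ adds one grain to the first vertex $w$ on the path from $\ell$ to $\mathsf r$ with $t_w<T_w$, and does nothing if there is no such vertex. For $v\in V$, the operator $\theta_v:\Omega\to\Omega$ fixes $t$ if $t_v=0$; otherwise it removes one grain from $v$ and adds it to the first vertex $w\neq v$ on the path from $v$ to $\mathsf r$ with $t_w<T_w$ (the grain is lost if there is no such vertex). The Landslide topple operator is $\tau_v=\theta_v^{T_v}$. Let $x_v>0$ $(v\in V)$ and $y_\ell>0$ $(\ell\in L)$ be real numbers with $\sum_{v\in V}x_v+\sum_{\ell\in L}y_\ell=1$. The Landslide sandpile chain on $\Omega$ applies in each step $\tau_v$ with probability $x_v$ and $\sigma_\ell$ with probability $y_\ell$; let $M_\tau$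 be its transition matrix, whose entry in row $t'$ and column $t$ is the probability of moving from $t$ to $t'$. For $S\subseteq V$ put $S^c=V\setminus S$ and $$x_S=\sum_{v\in S}x_v,\qquad y_S=\sum_{\ell\in L,\ \ell^\downarrow\subseteq S}y_\ell,\qquad T_S=\prod_{v\in S}T_v .$$ **Theorem.** The characteristic polynomial of $M_\tau$ is $$\det(\lambda\mathbb 1-M_\tau)=\prod_{S\subseteq V}(\lambda-y_S-x_S)^{T_{S^c}}.$$ Consequently every complex eigenvalue of $M_\tau$ is of the form $y_S+x_S$ for some $S\subseteq V$, and for every $\mu\in\mathbb C$ the multiplicity of $\mu$ as a root of the characteristic polynomial is $\sum_{S\subseteq V:\ y_S+x_S=\mu}T_{S^c}$. -/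

import Mathlib

open Polynomial

/-- `p` is the vertex sequence of a directed walk from `v` to `w` along the relation `Adj`. -/
def IsDirectedPath {V : Type*} (Adj : V → V → Prop) (v w : V) (p : List V) : Prop :=
  p.IsChain Adj ∧ p.head? = some v ∧ p.getLast? = some w

/-- An arborescence (edges directed towards the root): a directed graph with a root such that
from every vertex there is exactly one directed path to the root. -/
structure Arborescence (V : Type*) extends Digraph V where
  root : V
  existsUnique_path : ∀ v : V, ∃! p : List V, IsDirectedPath Adj v root p

/-- Configurations: at the vertex `v` there are between `0` and `T v` grains. -/
abbrev SandConfig {V : Type*} (T : V → ℕ) : Type _ := ∀ v : V, Fin (T v + 1)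

/-- Put one grain on the first vertex of the list `p` that has not reached its threshold;
nothing happens if there is no such vertex. -/
def SandConfig.addGrain {V : Type*} [DecidableEq V] {T : V → ℕ} :
    List V → SandConfig T → SandConfig T
  | [], t => t
  | w :: p, t =>
    if h : (t w : ℕ) < T w then
      Function.update t w ⟨(t w : ℕ) + 1, Nat.succ_lt_succ h⟩
    else SandConfig.addGrain p t

/-- Remove one grain from the vertex `v` (truncated at `0`). -/
def SandConfig.removeGrain {V : Type*} [DecidableEq V] {T : V → ℕ}
    (v : V) (t : SandConfig T) : SandConfig T :=
  Function.update t v ⟨(t v : ℕ) - 1, lt_of_le_of_lt (Nat.sub_le _ _) (t v).isLt⟩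

namespace Arborescence

/-- The directed path `v = v₀ → v₁ → ⋯ → vₐ = root`, as the list `[v₀, v₁, …, vₐ]`. -/
noncomputable def path {V : Type*} (A : Arborescence V) (v : V) : List V :=
  (A.existsUnique_path v).choose

/-- The set of vertices on the path from `v` to the root. -/
noncomputable def downset {V : Type*} [DecidableEq V] (A : Arborescence V) (v : V) : Finset V :=
  (A.path v).toFinset

open Classical in
/-- The leaves: the vertices without incoming edges. (The root counts as having an outgoing edge,
so it is a leaf only if it is the only vertex.) -/
noncomputable def leaves {V : Type*} [Fintype V] (A : Arborescence V) : Finset V :=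
  Finset.univ.filter fun v => ∀ w : V, ¬ A.Adj w v

/-- The source operator at `v`. -/
noncomputable def source {V : Type*} [DecidableEq V] (A : Arborescence V) (T : V → ℕ) (v : V)
    (t : SandConfig T) : SandConfig T :=
  t.addGrain (A.path v)

/-- The operator that topples a single grain at `v`: if there is a grain at `v`, it moves to the
first vertex after `v` on the path to the root that has not reached its threshold, and it leaves
the system if there is no such vertex. -/
noncomputable def toppleOne {V : Type*} [DecidableEq V] (A : Arborescence V) (T : V → ℕ) (v : V)
    (t : SandConfig T) : SandConfig T :=
  if (t v : ℕ) = 0 then t else (t.removeGrain v).addGrain (A.path v).tail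

/-- The Landslide topple operator at `v`. -/
noncomputable def topple {V : Type*} [DecidableEq V] (A : Arborescence V) (T : V → ℕ) (v : V) :
    SandConfig T → SandConfig T :=
  (A.toppleOne T v)^[T v]

/-- The transition matrix of the Landslide sandpile chain. Its entry at `(t', t)` is the
probability of moving from `t` to `t'` (stationary distributions are right eigenvectors). Only the
values of `y` at leaves are used. -/
noncomputable def landslideMatrix {V : Type*} [Fintype V] [DecidableEq V] (A : Arborescence V)
    (T : V → ℕ) (x y : V → ℝ) : Matrix (SandConfig T) (SandConfig T) ℝ :=
  Matrix.of fun t' t =>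
    (∑ v : V, if A.topple T v t = t' then x v else 0) +
      ∑ l ∈ A.leaves, if A.source T l t = t' then y l else 0

/-- `y_S`: the sum of `y l` over the leaves `l` whose path to the root lies in `S`. -/
noncomputable def leafSum {V : Type*} [Fintype V] [DecidableEq V] (A : Arborescence V)
    (y : V → ℝ) (S : Finset V) : ℝ :=
  ∑ l ∈ A.leaves with A.downset l ⊆ S, y l

end Arborescence

/-!
The transposed chain acts on functions on the configurations. In the basis of the indicator functions
of the down-sets `{t | t ≤ s}`, every operator `τ_v` and `σ_l` is triangular, for one common order of
the configurations `s`, and the eigenvalues can be read off the diagonal.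

* The function `t ↦ [σ_l t ≤ s]` equals `[t ≤ s]` if `s` is maximal on the whole path from `l`.
  Otherwise let `w` be the first vertex of the path where `s` is not maximal. A grain that gets past
  `w` violates the bound, so only the stretch from `l` to `w` matters, and the function is a
  combination of indicators of `{t | t ≤ s'}`, where `s' ≤ s`, `s' ≠ s`, and `s'` differs from `s` on
  this stretch only.
* The function `t ↦ [τ_v t ≤ s]` is the indicator of `{t | t ≤ s'}` with `s'` obtained from `s` by
  making the value at `v` maximal, if `s` is maximal everywhere below `v`. Otherwise let
  `w` be the first vertex below `v` where `s` is not maximal. Any `s'` that occurs differs from `s`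
  only at `v` and on the stretch below `v` down to `w`, and it is either strictly smaller than `s` on
  this stretch, or it agrees with `s` off `v` and vanishes at `v`; the latter comes with
  coefficient `1`.

The order compares the vertex nearest to the root first. At a vertex `v` with `s` maximal everywhere
below `v`, the values are ordered as `T v, 0, 1, …, T v - 1`, and otherwise as `0, 1, …, T v`
(`Arborescence.rank`). In both cases `τ_v` has the diagonal entry `1` at `s` if the value at `v` is
the first one, and `0` otherwise (`downsetCoeff_topple_self`); and `σ_l` has the entry `1` if all
vertices on the path from `l` have rank `0`, and `0` otherwise (`downsetCoeff_source_self`). So the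
diagonal entry of the chain is `y_S + x_S` with `S` the set of vertices of rank `0`. Since the rank is
a bijection of the set of configurations, each `S` occurs `∏ v ∈ Sᶜ, T v` times.
-/

/-! ### Splitting lists -/

theorem List.exists_first_split {α : Type*} {P : α → Prop} {l : List α} (h : ∃ a ∈ l, P a) :
    ∃ q a r, l = q ++ a :: r ∧ P a ∧ ∀ b ∈ q, ¬ P b := by
  induction l with
  | nil => simp at h
  | cons c l ih =>
    by_cases hc : P c
    · exact ⟨[], c, l, rfl, hc, by simp⟩
    · obtain ⟨q, a, r, rfl, ha, hq⟩ := ih (by simpa [hc] using h)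
      exact ⟨c :: q, a, r, rfl, ha, by simpa [hc] using hq⟩

theorem List.exists_last_split {α : Type*} {P : α → Prop} {l : List α} (h : ∃ a ∈ l, P a) :
    ∃ q a r, l = q ++ a :: r ∧ P a ∧ ∀ b ∈ r, ¬ P b := by
  induction l with
  | nil => simp at h
  | cons c l ih =>
    by_cases hl : ∃ a ∈ l, P a
    · obtain ⟨q, a, r, rfl, ha, hr⟩ := ih hl
      exact ⟨c :: q, a, r, rfl, ha, hr⟩
    · push Not at hl
      refine ⟨[], c, l, rfl, ?_, hl⟩
      obtain ⟨a, ha, hPa⟩ := h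
      rcases List.mem_cons.1 ha with rfl | ha
      · exact hPa
      · exact absurd hPa (hl a ha)

/-! ### Adding grains along a list -/

namespace SandConfig

variable {V : Type*} [DecidableEq V] {T : V → ℕ}

theorem le_addGrain (p : List V) (t : SandConfig T) (v : V) : t v ≤ addGrain p t v := by
  induction p with
  | nil => exact le_rfl
  | cons w p ih =>
    rw [addGrain]
    split_ifs with h
    · by_cases hv : v = w
      · subst hv
        simp [Fin.le_def]
      · simp [hv]
    · exact ih

theorem addGrain_update_of_notMem {p : List V} {u : V} (hu : u ∉ p) (t : SandConfig T)
    (j : Fin (T u + 1)) :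
    addGrain p (Function.update t u j) = Function.update (addGrain p t) u j := by
  induction p with
  | nil => rfl
  | cons w p ih =>
    have hwu : w ≠ u := fun h => hu (by simp [h])
    simp only [addGrain, Function.update_of_ne hwu, ih (fun h => hu (by simp [h]))]
    split_ifs
    · rw [Function.update_comm hwu]
    · rfl

theorem addGrain_apply_of_notMem {p : List V} {u : V} (hu : u ∉ p) (t : SandConfig T) :
    addGrain p t u = t u := by
  have := congrFun (addGrain_update_of_notMem hu t (t u)) u
  simpa using this

/-- A grain never gets past a vertex that has room for it. -/
theorem addGrain_append_cons {w : V} {t : SandConfig T} (h : (t w : ℕ) < T w) (q r : List V) :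
    addGrain (q ++ w :: r) t = addGrain (q ++ [w]) t := by
  induction q with
  | nil => simp [addGrain, h]
  | cons c q ih => simp only [List.cons_append, addGrain, ih]

theorem addGrain_apply_of_full {w : V} {t : SandConfig T} (h : (t w : ℕ) < T w) {q : List V}
    (r : List V) (hq : ∀ u ∈ q, ¬ (t u : ℕ) < T u) :
    (addGrain (q ++ w :: r) t w : ℕ) = t w + 1 := by
  induction q with
  | nil => simp [addGrain, h]
  | cons c q ih =>
    simp only [List.cons_append, addGrain, hq c (by simp), dite_false]
    exact ih fun u hu => hq u (by simp [hu])

theorem le_addGrain_iterate (p : List V) (k : ℕ) (t : SandConfig T) (v : V) :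
    t v ≤ ((addGrain p)^[k] t) v := by
  induction k generalizing t with
  | zero => exact le_rfl
  | succ k ih => exact (le_addGrain p t v).trans (ih _)

theorem addGrain_iterate_update_of_notMem {p : List V} {u : V} (hu : u ∉ p) (k : ℕ)
    (t : SandConfig T) (j : Fin (T u + 1)) :
    (addGrain p)^[k] (Function.update t u j) = Function.update ((addGrain p)^[k] t) u j := by
  induction k generalizing t with
  | zero => rfl
  | succ k ih => simp only [Function.iterate_succ_apply, addGrain_update_of_notMem hu, ih]

theorem addGrain_iterate_apply_of_notMem {p : List V} {u : V} (hu : u ∉ p) (k : ℕ)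
    (t : SandConfig T) : ((addGrain p)^[k] t) u = t u := by
  have := congrFun (addGrain_iterate_update_of_notMem hu k t (t u)) u
  simpa using this

/-- When all vertices of `p` are unconstrained by the bound `s`, adding grains along `p` does not
affect whether a configuration is bounded by `s`. -/
theorem addGrain_iterate_le_iff_of_full {p : List V} {s : SandConfig T}
    (hs : ∀ w ∈ p, s w = Fin.last _) (k : ℕ) (t : SandConfig T) :
    (∀ w, ((addGrain p)^[k] t) w ≤ s w) ↔ ∀ w, t w ≤ s w := by
  refine forall_congr' fun w => ?_
  by_cases hw : w ∈ p
  · simp [hs w hw, Fin.le_last]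
  · rw [addGrain_iterate_apply_of_notMem hw]

/-- If the bound `s` is not maximal at `w`, then a grain that gets past `w` violates the bound, so
that the vertices beyond `w` are irrelevant for whether the result is bounded by `s`. -/
theorem addGrain_iterate_le_iff_prefix {w : V} {s : SandConfig T} (hw : (s w : ℕ) < T w)
    (q r : List V) (k : ℕ) (t : SandConfig T) :
    (∀ u, ((addGrain (q ++ w :: r))^[k] t) u ≤ s u) ↔
      ∀ u, ((addGrain (q ++ [w]))^[k] t) u ≤ s u := by
  induction k generalizing t with
  | zero => rfl
  | succ k ih =>
    by_cases ht : t w ≤ s w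
    · simp only [Function.iterate_succ_apply]
      rw [addGrain_append_cons (lt_of_le_of_lt (Fin.le_def.1 ht) hw)]
      exact ih _
    · exact ⟨fun h => absurd ((le_addGrain_iterate _ _ _ _).trans (h w)) ht,
        fun h => absurd ((le_addGrain_iterate _ _ _ _).trans (h w)) ht⟩

/-- If `t` agrees with `s` down to the first vertex `w` at which `s` is not maximal, then the next
grain stops at `w` and violates the bound. -/
theorem not_addGrain_iterate_succ_le {w : V} {s t : SandConfig T} (hw : (s w : ℕ) < T w)
    {q : List V} (r : List V) (hq : ∀ u ∈ q, ¬ (s u : ℕ) < T u) (k : ℕ)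
    (ht : ∀ u ∈ q ++ [w], t u = s u) :
    ¬ ∀ u, ((addGrain (q ++ w :: r))^[k + 1] t) u ≤ s u := by
  intro h
  have h1 := Fin.le_def.1 ((le_addGrain_iterate (q ++ w :: r) k _ w).trans (h w))
  have htw := ht w (by simp)
  rw [addGrain_apply_of_full (by rwa [htw]) r
    (fun u hu => by rw [ht u (by simp [hu])]; exact hq u hu), htw] at h1
  omega

end SandConfig

/-! ### Paths and toppling -/

namespace Arborescence

variable {V : Type*} (A : Arborescence V)

theorem path_spec (v : V) : IsDirectedPath A.Adj v A.root (A.path v) :=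
  (A.existsUnique_path v).choose_spec.1

theorem path_eq_cons_tail (v : V) : A.path v = v :: (A.path v).tail := by
  have h := (A.path_spec v).2.1
  cases hp : A.path v with
  | nil => simp [hp] at h
  | cons w p => simp_all

theorem mem_path_self (v : V) : v ∈ A.path v := by
  rw [path_eq_cons_tail]; simp

/-- A final segment of the path from a vertex is again the path from its first vertex. -/
theorem path_of_path_eq_append {v w : V} {q r : List V} (h : A.path v = q ++ w :: r) :
    A.path w = w :: r := by
  have hs := A.path_spec v
  refine (A.existsUnique_path w).unique (A.path_spec w) ⟨?_, rfl, ?_⟩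
  · have := hs.1
    rw [h] at this
    exact this.right_of_append
  · have := hs.2.2
    rw [h] at this
    simpa [List.getLast?_append] using this

theorem path_suffix_of_mem {v w : V} (h : w ∈ A.path v) : A.path w <:+ A.path v := by
  obtain ⟨q, r, hqr⟩ := List.append_of_mem h
  exact ⟨q, by rw [A.path_of_path_eq_append hqr, hqr]⟩

theorem path_injective : Function.Injective A.path := fun v w h => by
  rw [A.path_eq_cons_tail v, A.path_eq_cons_tail w] at h
  exact (List.cons.inj h).1

theorem eq_of_mem_path_of_length_le {v w : V} (h : w ∈ A.path v)
    (hl : (A.path v).length ≤ (A.path w).length) : w = v :=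
  A.path_injective ((A.path_suffix_of_mem h).eq_of_length_le hl)

theorem mem_tail_path_iff {v w : V} : w ∈ (A.path v).tail ↔ w ∈ A.path v ∧ w ≠ v := by
  constructor
  · intro h
    refine ⟨List.mem_of_mem_tail h, ?_⟩
    rintro rfl
    obtain ⟨q, r, hqr⟩ := List.append_of_mem h
    have h1 := A.path_eq_cons_tail w
    rw [hqr] at h1
    have h2 := A.path_of_path_eq_append (q := w :: q) h1
    have := congrArg List.length (h1.symm.trans h2)
    simp at this
    omega
  · rintro ⟨h, hne⟩
    rw [A.path_eq_cons_tail v] at h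
    exact (List.mem_cons.1 h).resolve_left hne

theorem notMem_tail_path (v : V) : v ∉ (A.path v).tail := by
  simp [mem_tail_path_iff]

theorem path_nodup (v : V) : (A.path v).Nodup := by
  have h : ∀ l, l <:+ A.path v → l.Nodup := by
    intro l
    induction l with
    | nil => simp
    | cons c l ih =>
      rintro ⟨q, hq⟩
      refine List.nodup_cons.2 ⟨?_, ih ⟨q ++ [c], by simp [← hq]⟩⟩
      have := A.notMem_tail_path c
      rwa [A.path_of_path_eq_append hq.symm] at this
  exact h _ List.suffix_rfl

theorem tail_path_subset {v w : V} (h : w ∈ A.path v) {u : V} (hu : u ∈ (A.path w).tail) :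
    u ∈ (A.path v).tail := by
  obtain ⟨hu, hne⟩ := A.mem_tail_path_iff.1 hu
  have huv := (A.path_suffix_of_mem h).subset hu
  refine A.mem_tail_path_iff.2 ⟨huv, ?_⟩
  rintro rfl
  exact hne (A.eq_of_mem_path_of_length_le hu (A.path_suffix_of_mem h).length_le)

theorem mem_path_or_mem_path {a u w : V} (hu : u ∈ A.path a) (hw : w ∈ A.path a) :
    w ∈ A.path u ∨ u ∈ A.path w :=
  (List.suffix_or_suffix_of_suffix (A.path_suffix_of_mem hw) (A.path_suffix_of_mem hu)).imp
    (fun h => h.subset (A.mem_path_self w)) (fun h => h.subset (A.mem_path_self u))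

variable [DecidableEq V] {T : V → ℕ}

open SandConfig in
/-- A landslide at `v` empties `v` and lets its grains go down the path one by one. -/
theorem topple_eq (v : V) (t : SandConfig T) :
    A.topple T v t =
      (addGrain (A.path v).tail)^[(t v : ℕ)] (Function.update t v 0) := by
  have key : ∀ (n : ℕ) (t : SandConfig T), (t v : ℕ) ≤ n → (A.toppleOne T v)^[n] t =
      (addGrain (A.path v).tail)^[(t v : ℕ)] (Function.update t v 0) := by
    have hv := A.notMem_tail_path v
    intro n
    induction n with
    | zero =>
      intro t ht
      have h0 : t v = 0 := Fin.ext (by simpa using ht)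
      have h1 : Function.update t v 0 = t := by rw [← h0, Function.update_eq_self]
      rw [h1, h0]
      rfl
    | succ n ih =>
      intro t ht
      rw [Function.iterate_succ_apply, toppleOne]
      split_ifs with h0
      · exact ih t (by omega)
      · have hval : ((removeGrain v t).addGrain (A.path v).tail v : ℕ) = t v - 1 := by
          rw [addGrain_apply_of_notMem hv]; simp [removeGrain]
        rw [ih _ (by omega), hval, ← addGrain_update_of_notMem hv, ← Function.iterate_succ_apply]
        congr 1
        · rw [Nat.succ_eq_add_one, Nat.sub_add_cancel (Nat.pos_of_ne_zero h0)]
        · simp [removeGrain]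
  exact key _ t (Nat.lt_succ_iff.1 (t v).isLt)

end Arborescence

/-! ### The basis of indicators of down-sets -/

namespace SandConfig

variable {V : Type*} [DecidableEq V] {T : V → ℕ}

/-- The Möbius function of the chain `Fin (n + 1)`, with the larger argument first. -/
def chainMoebius {n : ℕ} (a b : Fin (n + 1)) : ℝ :=
  (if a = b then 1 else 0) - if (a : ℕ) = b + 1 then 1 else 0

theorem le_of_chainMoebius_ne_zero {n : ℕ} {a b : Fin (n + 1)} (h : chainMoebius a b ≠ 0) :
    b ≤ a := by
  by_contra hab
  rw [Fin.le_def] at hab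
  refine h ?_
  rw [chainMoebius, if_neg (by rintro rfl; omega), if_neg (by omega), sub_zero]

theorem chainMoebius_self {n : ℕ} (a : Fin (n + 1)) : chainMoebius a a = 1 := by
  simp [chainMoebius]

theorem chainMoebius_zero {n : ℕ} (b : Fin (n + 1)) :
    chainMoebius 0 b = if b = 0 then 1 else 0 := by
  simp [chainMoebius, eq_comm]

theorem sum_le_chainMoebius {n : ℕ} (a b : Fin (n + 1)) :
    ∑ j, (if j ≤ a then chainMoebius j b else 0) = if b = a then 1 else 0 := by
  have h1 : ∑ j : Fin (n + 1), (if j ≤ a then (if j = b then (1 : ℝ) else 0) else 0) =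
      if b ≤ a then 1 else 0 := by
    rw [Finset.sum_eq_single b] <;> simp +contextual
  have h2 : ∑ j : Fin (n + 1), (if j ≤ a then (if (j : ℕ) = b + 1 then (1 : ℝ) else 0) else 0) =
      if b < a then 1 else 0 := by
    by_cases hb : (b : ℕ) + 1 < n + 1
    · rw [Finset.sum_eq_single ⟨b + 1, hb⟩]
      · simp only [Fin.le_def, Fin.lt_def, Nat.succ_le_iff, if_true]
      · intro j _ hj
        rw [if_neg (fun h => hj (Fin.ext h))]
        simp
      · simp
    · rw [if_neg (by rw [Fin.lt_def]; omega)]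
      refine Finset.sum_eq_zero fun j _ => ?_
      rw [if_neg (by omega : ¬(j : ℕ) = b + 1), ite_self]
  have h3 : ∀ j : Fin (n + 1), (if j ≤ a then chainMoebius j b else 0) =
      (if j ≤ a then (if j = b then (1 : ℝ) else 0) else 0) -
        (if j ≤ a then (if (j : ℕ) = b + 1 then (1 : ℝ) else 0) else 0) := by
    intro j
    by_cases hj : j ≤ a <;> simp [hj, chainMoebius]
  rw [Finset.sum_congr rfl fun j _ => h3 j, Finset.sum_sub_distrib, h1, h2]
  rcases lt_trichotomy b a with h | h | h
  · simp [h, h.le, h.ne]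
  · simp [h]
  · simp [h.not_ge, h.not_gt, h.ne']

variable [Fintype V]

/-- The matrix entry at `(s, s')` of the operator that `g` induces on functions by composition, in
the basis of the indicator functions of the down-sets `{t | t ≤ s}`: the function
`t ↦ [g t ≤ s]` is the combination of the functions `t ↦ [t ≤ s']` with the
coefficients `downsetCoeff g s s'`. -/
def downsetCoeff (g : SandConfig T → SandConfig T) (s s' : SandConfig T) : ℝ :=
  ∑ t, if ∀ w, g t w ≤ s w then ∏ v, chainMoebius (t v) (s' v) else 0

theorem downsetCoeff_congr {g g' : SandConfig T → SandConfig T} {s s₁ : SandConfig T}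
    (h : ∀ t, (∀ w, g t w ≤ s w) ↔ ∀ w, g' t w ≤ s₁ w) (s' : SandConfig T) :
    downsetCoeff g s s' = downsetCoeff g' s₁ s' :=
  Finset.sum_congr rfl fun t _ => by simp only [h t]

theorem downsetCoeff_id (s s' : SandConfig T) :
    downsetCoeff id s s' = if s' = s then 1 else 0 := by
  have h : ∀ t : SandConfig T, (if ∀ w, id t w ≤ s w then ∏ v, chainMoebius (t v) (s' v) else 0) =
      ∏ v, if t v ≤ s v then chainMoebius (t v) (s' v) else 0 := by
    intro t
    by_cases ht : ∀ w, t w ≤ s w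
    · simp [ht]
    · rw [if_neg (by exact ht)]
      push Not at ht
      obtain ⟨w, hw⟩ := ht
      exact (Finset.prod_eq_zero (Finset.mem_univ w) (if_neg hw.not_ge)).symm
  rw [downsetCoeff, Finset.sum_congr rfl fun t _ => h t,
    ← Fintype.prod_sum fun v (j : Fin (T v + 1)) => if j ≤ s v then chainMoebius j (s' v) else 0]
  simp only [sum_le_chainMoebius]
  by_cases hs : s' = s
  · simp [hs]
  · rw [if_neg hs]
    obtain ⟨w, hw⟩ := Function.ne_iff.1 hs
    exact Finset.prod_eq_zero (Finset.mem_univ w) (if_neg hw)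

/-- A coefficient vanishes unless the bound `s` can be met above `s'`. -/
theorem exists_of_downsetCoeff_ne_zero {g : SandConfig T → SandConfig T} {s s' : SandConfig T}
    (h : downsetCoeff g s s' ≠ 0) :
    ∃ t, (∀ w, g t w ≤ s w) ∧ ∀ w, s' w ≤ t w := by
  obtain ⟨t, -, ht⟩ := Finset.exists_ne_zero_of_sum_ne_zero h
  refine ⟨t, ?_, fun w => ?_⟩
  · by_contra hg
    exact ht (if_neg hg)
  · refine le_of_chainMoebius_ne_zero fun h0 => ht ?_
    split_ifs
    · exact Finset.prod_eq_zero (Finset.mem_univ w) h0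
    · rfl

theorem downsetCoeff_eq_single {g : SandConfig T → SandConfig T} {s s' : SandConfig T}
    (t₀ : SandConfig T)
    (h : ∀ t, (∀ w, g t w ≤ s w) → (∀ w, s' w ≤ t w) → t = t₀) :
    downsetCoeff g s s' =
      if ∀ w, g t₀ w ≤ s w then ∏ v, chainMoebius (t₀ v) (s' v) else 0 := by
  refine Finset.sum_eq_single t₀ (fun t _ hne => ?_) (by simp)
  split_ifs with hg
  · by_contra h0
    refine hne (h t hg fun w => le_of_chainMoebius_ne_zero fun hw => h0 ?_)
    exact Finset.prod_eq_zero (Finset.mem_univ w) hw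
  · rfl

/-- A coordinate that `g` neither changes nor depends on is the same in `s` and in `s'`. -/
theorem eq_of_downsetCoeff_ne_zero {g : SandConfig T → SandConfig T} {s s' : SandConfig T}
    {u : V} (hg : ∀ t j, g (Function.update t u j) = Function.update (g t) u j)
    (h : downsetCoeff g s s' ≠ 0) : s' u = s u := by
  by_contra hne
  refine h ?_
  rw [downsetCoeff, ← (Equiv.piSplitAt u fun v => Fin (T v + 1)).symm.sum_comp,
    Fintype.sum_prod_type_right]
  refine Finset.sum_eq_zero fun r _ => ?_
  set t₀ : SandConfig T := (Equiv.piSplitAt u fun v => Fin (T v + 1)).symm (0, r) with ht₀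
  have hup : ∀ j, (Equiv.piSplitAt u fun v => Fin (T v + 1)).symm (j, r) =
      Function.update t₀ u j := by
    intro j
    ext v
    by_cases hv : v = u
    · subst hv; simp
    · simp [hv, ht₀]
  have hterm : ∀ j, (if ∀ w, g (Function.update t₀ u j) w ≤ s w then
        ∏ v, chainMoebius (Function.update t₀ u j v) (s' v) else 0) =
      (if j ≤ s u then chainMoebius j (s' u) else 0) *
        if ∀ w ≠ u, g t₀ w ≤ s w then
          ∏ v ∈ Finset.univ.erase u, chainMoebius (t₀ v) (s' v) else 0 := by
    intro j
    have h1 : (∀ w, g (Function.update t₀ u j) w ≤ s w) ↔ j ≤ s u ∧ ∀ w ≠ u, g t₀ w ≤ s w := by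
      rw [hg]
      exact Function.forall_update_iff (g t₀) (p := fun w a => a ≤ s w)
    have h2 : ∏ v, chainMoebius (Function.update t₀ u j v) (s' v) =
        chainMoebius j (s' u) * ∏ v ∈ Finset.univ.erase u, chainMoebius (t₀ v) (s' v) := by
      rw [← Finset.mul_prod_erase _ _ (Finset.mem_univ u), Function.update_self]
      congr 1
      refine Finset.prod_congr rfl fun v hv => ?_
      rw [Function.update_of_ne (Finset.ne_of_mem_erase hv)]
    rw [h2, ite_mul, zero_mul, mul_ite, mul_zero]
    simp only [h1, ite_and]
  simp only [hup, hterm]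
  rw [← Finset.sum_mul, sum_le_chainMoebius, if_neg hne, zero_mul]

end SandConfig

/-! ### Triangularity of the operators -/

namespace Arborescence

open SandConfig

variable {V : Type*} (A : Arborescence V) {T : V → ℕ}

/-- The rank of the value `s v` in the order for which the operators are triangular. When all
vertices below `v` are at their threshold, the maximal value comes first, followed by
`0, 1, …`; otherwise the order is the usual one. -/
noncomputable def rank (s : SandConfig T) : SandConfig T := fun v =>
  if ∀ w ∈ (A.path v).tail, s w = Fin.last _ then s v + 1 else s v

/-- The values of `s` can be recovered from the ranks, starting from the root. -/
theorem rank_injective : Function.Injective (A.rank : SandConfig T → SandConfig T) := by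
  intro s s' h
  funext v
  induction hn : (A.path v).length using Nat.strong_induction_on generalizing v with
  | _ n ih =>
    have hw : ∀ w ∈ (A.path v).tail, s w = s' w := by
      intro w hw
      obtain ⟨hw, hne⟩ := A.mem_tail_path_iff.1 hw
      refine ih _ ?_ w rfl
      rw [← hn]
      by_contra hlt
      exact hne (A.eq_of_mem_path_of_length_le hw (not_lt.1 hlt))
    have hv := congrFun h v
    by_cases hs : ∀ w ∈ (A.path v).tail, s w = Fin.last _
    · have hs' : ∀ w ∈ (A.path v).tail, s' w = Fin.last _ := fun w hm => by rw [← hw w hm, hs w hm]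
      rw [rank, rank, if_pos hs, if_pos hs'] at hv
      exact add_right_cancel hv
    · have hs' : ¬ ∀ w ∈ (A.path v).tail, s' w = Fin.last _ :=
        fun h' => hs fun w hm => by rw [hw w hm, h' w hm]
      rwa [rank, rank, if_neg hs, if_neg hs'] at hv

theorem rank_eq_zero_iff_of_full {s : SandConfig T} {v : V}
    (h : ∀ w ∈ (A.path v).tail, s w = Fin.last _) : A.rank s v = 0 ↔ s v = Fin.last _ := by
  rw [rank, if_pos h, ← Fin.last_add_one (T v)]
  exact add_left_inj 1

theorem rank_eq_of_not_full {s : SandConfig T} {v : V}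
    (h : ¬ ∀ w ∈ (A.path v).tail, s w = Fin.last _) : A.rank s v = s v := if_neg h

/-- A path consists of vertices of rank `0` exactly when all its vertices are at the threshold. -/
theorem forall_rank_eq_zero_iff {s : SandConfig T} {v : V} :
    (∀ w ∈ A.path v, A.rank s w = 0) ↔ ∀ w ∈ A.path v, s w = Fin.last _ := by
  constructor
  · intro h w hw
    -- the last vertex of the path that is not full would have only full vertices below it
    by_contra hne
    obtain ⟨q, u, r, hp, hu, hr⟩ :=
      List.exists_last_split (P := fun w => s w ≠ Fin.last _) ⟨w, hw, hne⟩
    have hpu := A.path_of_path_eq_append hp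
    have hfull : ∀ w ∈ (A.path u).tail, s w = Fin.last _ := by
      rw [hpu]
      exact fun w hw => not_not.1 (hr w hw)
    exact hu ((A.rank_eq_zero_iff_of_full hfull).1 (h u (by simp [hp])))
  · intro h w hw
    exact (A.rank_eq_zero_iff_of_full fun u hu =>
      h u (List.mem_of_mem_tail (A.tail_path_subset hw hu))).2 (h w hw)

/-- The strict comparison of two configurations at the vertex nearest to the root where they
differ, provided that there is only one such vertex. -/
def DepthLT (k k' : SandConfig T) : Prop :=
  ∃ u, k u < k' u ∧
    ∀ w, (A.path w).length ≤ (A.path u).length → w ≠ u → k w = k' w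

variable {A}

/-- If `s` and `s'` differ only on the path from `a`, and `u` is the vertex nearest to the root where
they differ, then the comparison of the ranks is decided at `u`. -/
theorem depthLT_rank {a u : V} {s s' : SandConfig T} (hoff : ∀ w, w ∉ A.path a → s' w = s w)
    (hu : u ∈ A.path a) (htail : ∀ w ∈ (A.path u).tail, s' w = s w)
    (hlt : A.rank s' u < A.rank s u) : A.DepthLT (A.rank s') (A.rank s) := by
  refine ⟨u, hlt, fun w hw hne => ?_⟩
  have hagree : ∀ z, (A.path z).length ≤ (A.path u).length → z ≠ u → s' z = s z := by
    intro z hz hzu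
    by_cases hza : z ∈ A.path a
    · rcases A.mem_path_or_mem_path hu hza with h | h
      · exact htail z (A.mem_tail_path_iff.2 ⟨h, hzu⟩)
      · exact absurd (A.eq_of_mem_path_of_length_le h hz).symm hzu
    · exact hoff z hza
  have hag : ∀ z ∈ (A.path w).tail, s' z = s z := by
    intro z hz
    obtain ⟨hz, hzw⟩ := A.mem_tail_path_iff.1 hz
    refine hagree z ((A.path_suffix_of_mem hz).length_le.trans hw) ?_
    rintro rfl
    exact hzw (A.eq_of_mem_path_of_length_le hz hw)
  have hiff : (∀ z ∈ (A.path w).tail, s' z = Fin.last _) ↔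
      ∀ z ∈ (A.path w).tail, s z = Fin.last _ :=
    forall₂_congr fun z hz => by rw [hag z hz]
  simp only [rank, hiff, hagree w hw hne]

/-- Unless `s u` is the first value in the order at `u`, lowering the number of grains at `u` lowers
the rank. -/
theorem rank_lt_rank {u : V} {s s' : SandConfig T}
    (htail : ∀ w ∈ (A.path u).tail, s' w = s w) (hlt : s' u < s u)
    (h : s u ≠ Fin.last _ ∨ ∃ w ∈ (A.path u).tail, s w ≠ Fin.last _) :
    A.rank s' u < A.rank s u := by
  have hiff : (∀ z ∈ (A.path u).tail, s' z = Fin.last _) ↔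
      ∀ z ∈ (A.path u).tail, s z = Fin.last _ :=
    forall₂_congr fun z hz => by rw [htail z hz]
  by_cases hs : ∀ z ∈ (A.path u).tail, s z = Fin.last _
  · have hu : s u ≠ Fin.last _ := h.resolve_right fun ⟨w, hw, hne⟩ => hne (hs w hw)
    rw [rank, rank, if_pos hs, if_pos (hiff.2 hs), Fin.lt_def,
      Fin.val_add_one_of_lt (Fin.lt_last_iff_ne_last.2 hu),
      Fin.val_add_one_of_lt (hlt.trans (Fin.lt_last_iff_ne_last.2 hu))]
    exact Nat.succ_lt_succ hlt
  · rwa [rank_eq_of_not_full A hs, rank_eq_of_not_full A fun h' => hs (hiff.1 h')]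

/-- Lowering `s` on the stretch `q ++ [w]` of the path from `a` lowers the ranks when `w` is not full
in `s`: the vertices of `q` have `w` below them, so that they carry the usual order. Above the
stretch, on `b`, the change is arbitrary. -/
theorem depthLT_rank_of_le {a w : V} {b q r : List V} {s s' : SandConfig T}
    (hp : A.path a = b ++ (q ++ w :: r)) (hw : s w ≠ Fin.last _)
    (hoff : ∀ z, z ∉ A.path a → s' z = s z) (hr : ∀ z ∈ r, s' z = s z)
    (hle : ∀ z ∈ q ++ [w], s' z ≤ s z) (hne : ∃ z ∈ q ++ [w], s' z ≠ s z) :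
    A.DepthLT (A.rank s') (A.rank s) := by
  obtain ⟨q₂, u, r₂, hl, hu, hr₂⟩ :=
    List.exists_last_split (l := q ++ w :: r) (P := fun z => s' z ≠ s z) (by
      obtain ⟨z, hz, hz'⟩ := hne
      refine ⟨z, ?_, hz'⟩
      simp only [List.mem_append, List.mem_cons, List.not_mem_nil, or_false] at hz ⊢
      tauto)
  have hpu : A.path u = u :: r₂ :=
    A.path_of_path_eq_append (q := b ++ q₂) (by rw [hp, hl, List.append_assoc])
  have hpw : A.path w = w :: r :=
    A.path_of_path_eq_append (q := b ++ q) (by rw [hp, List.append_assoc])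
  have hua : u ∈ A.path a := by simp [hp, hl]
  have hwa : w ∈ A.path a := by simp [hp]
  have hur : u ∉ r := fun h => hu (hr u h)
  have huq : u ∈ q ++ [w] := by
    have : u ∈ q ++ w :: r := by simp [hl]
    simp only [List.mem_append, List.mem_cons, List.not_mem_nil, or_false] at this ⊢
    tauto
  have htail : ∀ z ∈ (A.path u).tail, s' z = s z := by
    rw [hpu]
    exact fun z hz => not_not.1 (hr₂ z hz)
  refine depthLT_rank hoff hua htail (rank_lt_rank htail (lt_of_le_of_ne (hle u huq) hu) ?_)
  by_cases huw : u = w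
  · exact Or.inl (huw ▸ hw)
  · refine Or.inr ⟨w, A.mem_tail_path_iff.2 ⟨?_, Ne.symm huw⟩, hw⟩
    refine (A.mem_path_or_mem_path hua hwa).resolve_right fun h => ?_
    rw [hpw] at h
    exact (List.mem_cons.1 h).elim huw hur

theorem val_lt_of_ne_last {s : SandConfig T} {w : V} (h : s w ≠ Fin.last _) : (s w : ℕ) < T w :=
  Fin.lt_def.1 (Fin.lt_last_iff_ne_last.2 h)

variable [DecidableEq V]

/-- When everything below `v` is full in `s`, the bound is met after the landslide whatever the
number of grains at `v` was. -/
theorem topple_le_iff_of_full {v : V} {s : SandConfig T}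
    (h : ∀ w ∈ (A.path v).tail, s w = Fin.last _) (t : SandConfig T) :
    (∀ w, A.topple T v t w ≤ s w) ↔ ∀ w, t w ≤ Function.update s v (Fin.last _) w := by
  rw [topple_eq, addGrain_iterate_le_iff_of_full h,
    Function.forall_update_iff t (p := fun w a => a ≤ s w),
    Function.forall_update_iff s (p := fun w a => t w ≤ a)]
  simp [Fin.le_last]

variable [Fintype V]

theorem downsetCoeff_source_of_full {l : V} {s : SandConfig T}
    (h : ∀ w ∈ A.path l, s w = Fin.last _) (s' : SandConfig T) :
    downsetCoeff (A.source T l) s s' = if s' = s then 1 else 0 := by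
  rw [← downsetCoeff_id]
  exact downsetCoeff_congr (fun t => addGrain_iterate_le_iff_of_full h 1 t) s'

/-- If the path from `l` is not full in `s`, then `σ_l t ≤ s` fails for exactly those `t ≤ s` that
agree with `s` on the path down to the first vertex that is not full. Hence `s' = s` does not occur,
and all `s'` that occur lie below `s`. -/
theorem downsetCoeff_source_of_not_full {l : V} {s s' : SandConfig T}
    (h : ¬ ∀ w ∈ A.path l, s w = Fin.last _) (h0 : downsetCoeff (A.source T l) s s' ≠ 0) :
    A.DepthLT (A.rank s') (A.rank s) := by
  push Not at h
  obtain ⟨q, w, r, hp, hw, hq⟩ := List.exists_first_split h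
  have hwT := val_lt_of_ne_last hw
  have hG : downsetCoeff (A.source T l) s s' = downsetCoeff (addGrain (q ++ [w])) s s' :=
    downsetCoeff_congr (fun t => by
      rw [source, hp]
      exact addGrain_iterate_le_iff_prefix hwT q r 1 t) s'
  rw [hG] at h0
  have hoff : ∀ z, z ∉ q ++ [w] → s' z = s z := fun z hz =>
    eq_of_downsetCoeff_ne_zero (fun t j => addGrain_update_of_notMem hz t j) h0
  obtain ⟨t, hts, hst⟩ := exists_of_downsetCoeff_ne_zero h0
  have hle : ∀ z, s' z ≤ s z := fun z =>
    (hst z).trans ((le_addGrain (q ++ [w]) t z).trans (hts z))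
  have hne : s' ≠ s := by
    rintro rfl
    have htt : t = s' := funext fun z =>
      le_antisymm ((le_addGrain (q ++ [w]) t z).trans (hts z)) (hst z)
    subst htt
    refine not_addGrain_iterate_succ_le hwT (q := q) [] (fun u hu => ?_) 0 (fun _ _ => rfl) hts
    rw [not_not.1 (hq u hu)]
    simp
  obtain ⟨z, hz⟩ := Function.ne_iff.1 hne
  have hnd : ∀ z ∈ r, z ∉ q ++ [w] := by
    intro z hz hzq
    have hnd := A.path_nodup l
    rw [hp, List.append_cons] at hnd
    exact (List.disjoint_of_nodup_append hnd) hzq hz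
  refine depthLT_rank_of_le (b := []) hp hw (fun z hz => hoff z fun h => hz ?_)
    (fun z hz => hoff z (hnd z hz)) (fun z _ => hle z)
    ⟨z, by by_contra h; exact hz (hoff z h), hz⟩
  rw [hp]
  simp only [List.mem_append, List.mem_cons, List.not_mem_nil, or_false] at h ⊢
  tauto

theorem downsetCoeff_topple_of_full {v : V} {s : SandConfig T}
    (h : ∀ w ∈ (A.path v).tail, s w = Fin.last _) (s' : SandConfig T) :
    downsetCoeff (A.topple T v) s s' =
      if s' = Function.update s v (Fin.last _) then 1 else 0 := by
  rw [← downsetCoeff_id]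
  exact downsetCoeff_congr (topple_le_iff_of_full h) s'

/-- When something below `v` is not full in `s`, the vertex `v` must be empty for the other
coordinates to be able to stay at `s`. -/
theorem downsetCoeff_topple_of_not_full_of_eq {v : V} {s s' : SandConfig T}
    (h : ¬ ∀ w ∈ (A.path v).tail, s w = Fin.last _) (hs : ∀ w ≠ v, s' w = s w) :
    downsetCoeff (A.topple T v) s s' = if s' v = 0 then 1 else 0 := by
  push Not at h
  obtain ⟨q, w, r, hp, hw, hq⟩ := List.exists_first_split h
  have hvp := A.notMem_tail_path v
  have hwT := val_lt_of_ne_last hw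
  rw [downsetCoeff_eq_single (Function.update s v 0), if_pos]
  · rw [← Finset.mul_prod_erase _ _ (Finset.mem_univ v), Function.update_self,
      chainMoebius_zero, Finset.prod_eq_one, mul_one]
    intro u hu
    rw [Function.update_of_ne (Finset.ne_of_mem_erase hu), hs u (Finset.ne_of_mem_erase hu),
      chainMoebius_self]
  · intro u
    rw [topple_eq, Function.update_self, Function.update_idem]
    by_cases hu : u = v
    · subst hu
      simp
    · simp [hu]
  · -- with a grain at `v`, the full stretch down to `w` would make `w` exceed the bound
    intro t ht hst
    rw [topple_eq] at ht
    have heq : ∀ u ≠ v, t u = s u := by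
      intro u hu
      refine le_antisymm (le_trans ?_ (ht u)) (hs u hu ▸ hst u)
      have := le_addGrain_iterate (A.path v).tail (t v) (Function.update t v 0) u
      rwa [Function.update_of_ne hu] at this
    have htv : t v = 0 := by
      by_contra hne
      obtain ⟨k, hk⟩ := Nat.exists_eq_succ_of_ne_zero (fun h0 => hne (Fin.ext h0) : (t v : ℕ) ≠ 0)
      rw [hk, hp] at ht
      refine not_addGrain_iterate_succ_le hwT r (fun u hu => ?_) k (fun u hu => ?_) ht
      · rw [not_not.1 (hq u hu)]
        simp
      · have huv : u ≠ v := by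
          rintro rfl
          refine hvp ?_
          rw [hp]
          simp only [List.mem_append, List.mem_cons, List.not_mem_nil, or_false] at hu ⊢
          tauto
        rw [Function.update_of_ne huv, heq u huv]
    funext u
    by_cases hu : u = v
    · subst hu
      simpa using htv
    · rw [Function.update_of_ne hu, heq u hu]

theorem downsetCoeff_topple_of_not_full {v : V} {s s' : SandConfig T}
    (h : ¬ ∀ w ∈ (A.path v).tail, s w = Fin.last _) (hne : s' ≠ s)
    (h0 : downsetCoeff (A.topple T v) s s' ≠ 0) :
    A.DepthLT (A.rank s') (A.rank s) := by
  by_cases hs : ∀ w ≠ v, s' w = s w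
  · rw [downsetCoeff_topple_of_not_full_of_eq h hs] at h0
    have hv0 : s' v = 0 := by
      by_contra h'
      exact h0 (if_neg h')
    have htail : ∀ w ∈ (A.path v).tail, s' w = s w := fun w hw =>
      hs w (A.mem_tail_path_iff.1 hw).2
    have hsv : s' v ≠ s v := fun h' => hne (funext fun w => by
      by_cases hw : w = v
      · rw [hw, h']
      · exact hs w hw)
    push Not at h
    refine depthLT_rank (a := v) (fun w hw => hs w ?_) (A.mem_path_self v) htail
      (rank_lt_rank htail (lt_of_le_of_ne (hv0 ▸ Fin.zero_le _) hsv) (Or.inr h))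
    rintro rfl
    exact hw (A.mem_path_self w)
  · push Not at h hs
    obtain ⟨q, w, r, hp, hw, hq⟩ := List.exists_first_split h
    have hpv := A.path_eq_cons_tail v
    rw [hp] at hpv
    have hvp := A.notMem_tail_path v
    have hwT := val_lt_of_ne_last hw
    have hsub : ∀ z ∈ q ++ [w], z ∈ (A.path v).tail := by
      intro z hz
      rw [hp]
      simp only [List.mem_append, List.mem_cons, List.not_mem_nil, or_false] at hz ⊢
      tauto
    set G : SandConfig T → SandConfig T := fun t =>
      (addGrain (q ++ [w]))^[(t v : ℕ)] (Function.update t v 0) with hGdef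
    have hG : downsetCoeff (A.topple T v) s s' = downsetCoeff G s s' :=
      downsetCoeff_congr (fun t => by
        rw [topple_eq, hp]
        exact addGrain_iterate_le_iff_prefix hwT q r _ _) s'
    rw [hG] at h0
    have hoff : ∀ z, z ≠ v → z ∉ q ++ [w] → s' z = s z := fun z hzv hz =>
      eq_of_downsetCoeff_ne_zero (fun t j => by
        simp only [hGdef]
        rw [Function.update_of_ne hzv.symm, Function.update_comm hzv,
          addGrain_iterate_update_of_notMem hz]) h0
    obtain ⟨t, hts, hst⟩ := exists_of_downsetCoeff_ne_zero h0
    have hle : ∀ z ≠ v, s' z ≤ s z := by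
      intro z hz
      refine (hst z).trans (le_trans ?_ (hts z))
      have := le_addGrain_iterate (q ++ [w]) (t v) (Function.update t v 0) z
      rwa [Function.update_of_ne hz] at this
    obtain ⟨z, hzv, hz⟩ := hs
    refine depthLT_rank_of_le (a := v) (b := [v]) hpv hw (fun z hz => ?_) (fun z hz => ?_)
      (fun z hz => hle z ?_) ⟨z, by_contra fun h => hz (hoff z hzv h), hz⟩
    · refine hoff z ?_ fun h => hz (List.mem_of_mem_tail (hsub z h))
      rintro rfl
      exact hz (A.mem_path_self z)
    · refine hoff z ?_ fun hzq => ?_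
      · rintro rfl
        exact hvp (by rw [hp]; simp [hz])
      · have hnd := (A.path_nodup v).tail
        rw [hp, List.append_cons] at hnd
        exact (List.disjoint_of_nodup_append hnd) hzq hz
    · exact (A.mem_tail_path_iff.1 (hsub z hz)).2

theorem downsetCoeff_source_self (l : V) (s : SandConfig T) :
    downsetCoeff (A.source T l) s s =
      if A.downset l ⊆ Finset.univ.filter (fun v => A.rank s v = 0) then 1 else 0 := by
  have hiff : A.downset l ⊆ Finset.univ.filter (fun v => A.rank s v = 0) ↔
      ∀ w ∈ A.path l, s w = Fin.last _ := by
    rw [← A.forall_rank_eq_zero_iff]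
    simp [downset, Finset.subset_iff]
  by_cases h : ∀ w ∈ A.path l, s w = Fin.last _
  · rw [downsetCoeff_source_of_full h, if_pos rfl, if_pos (hiff.2 h)]
  · rw [if_neg (mt hiff.1 h)]
    by_contra h0
    obtain ⟨u, hu, -⟩ := downsetCoeff_source_of_not_full h h0
    exact lt_irrefl _ hu

theorem downsetCoeff_topple_self (v : V) (s : SandConfig T) :
    downsetCoeff (A.topple T v) s s = if A.rank s v = 0 then 1 else 0 := by
  by_cases h : ∀ w ∈ (A.path v).tail, s w = Fin.last _
  · simp only [downsetCoeff_topple_of_full h, A.rank_eq_zero_iff_of_full h,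
      Function.eq_update_self_iff]
  · simp only [downsetCoeff_topple_of_not_full_of_eq h fun _ _ => rfl, A.rank_eq_of_not_full h]

theorem depthLT_of_downsetCoeff_source_ne_zero {l : V} {s s' : SandConfig T} (hne : s' ≠ s)
    (h0 : downsetCoeff (A.source T l) s s' ≠ 0) : A.DepthLT (A.rank s') (A.rank s) := by
  by_cases h : ∀ w ∈ A.path l, s w = Fin.last _
  · rw [downsetCoeff_source_of_full h, if_neg hne] at h0
    exact absurd rfl h0
  · exact downsetCoeff_source_of_not_full h h0

theorem depthLT_of_downsetCoeff_topple_ne_zero {v : V} {s s' : SandConfig T} (hne : s' ≠ s)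
    (h0 : downsetCoeff (A.topple T v) s s' ≠ 0) : A.DepthLT (A.rank s') (A.rank s) := by
  by_cases h : ∀ w ∈ (A.path v).tail, s w = Fin.last _
  · rw [downsetCoeff_topple_of_full h] at h0
    have hs : s' = Function.update s v (Fin.last _) := by
      by_contra h'
      exact h0 (if_neg h')
    have htail : ∀ w ∈ (A.path v).tail, s' w = s w := fun w hw => by
      rw [hs, Function.update_of_ne (A.mem_tail_path_iff.1 hw).2]
    have hv : A.rank s' v = 0 :=
      (A.rank_eq_zero_iff_of_full fun w hw => by rw [htail w hw, h w hw]).2 (by simp [hs])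
    have hv' : A.rank s v ≠ 0 := by
      rw [Ne, A.rank_eq_zero_iff_of_full h]
      intro h'
      rw [← h', Function.update_eq_self] at hs
      exact hne hs
    refine depthLT_rank (a := v) (fun w hw => ?_) (A.mem_path_self v) htail
      (by rw [hv]; exact Fin.pos_iff_ne_zero.2 hv')
    rw [hs, Function.update_of_ne]
    rintro rfl
    exact hw (A.mem_path_self w)
  · exact downsetCoeff_topple_of_not_full h hne h0

end Arborescence

/-! ### The characteristic polynomial -/

/-- The characteristic polynomial of a matrix that is triangular with respect to an injective
ranking of its indices. -/
theorem Matrix.BlockTriangular.charpoly_of_injective {n α R : Type*} [Fintype n] [DecidableEq n]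
    [CommRing R] [LinearOrder α] {M : Matrix n n R} {b : n → α} (hM : M.BlockTriangular b)
    (hb : Function.Injective b) : M.charpoly = ∏ i, (X - C (M i i)) := by
  rw [hM.charpoly, Finset.prod_image hb.injOn]
  refine Finset.prod_congr rfl fun i _ => ?_
  let _ : Unique { a // b a = b i } := ⟨⟨⟨i, rfl⟩⟩, fun j => Subtype.ext (hb j.2)⟩
  rw [Matrix.charpoly, Matrix.det_unique, Matrix.charmatrix_apply_eq]
  rfl

namespace SandConfig

variable {V : Type*} [Fintype V] [DecidableEq V] {T : V → ℕ}

/-- The transition matrix of the deterministic move `g`. -/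
def moveMatrix (g : SandConfig T → SandConfig T) : Matrix (SandConfig T) (SandConfig T) ℝ :=
  Matrix.of fun t' t => if g t = t' then 1 else 0

/-- The zeta matrix of the product order: its rows are the indicator functions of down-sets. -/
def zetaMatrix (T : V → ℕ) : Matrix (SandConfig T) (SandConfig T) ℝ :=
  Matrix.of fun s t => if ∀ w, t w ≤ s w then 1 else 0

/-- The Möbius matrix of the product order. -/
def moebiusMatrix (T : V → ℕ) : Matrix (SandConfig T) (SandConfig T) ℝ :=
  Matrix.of fun t s => ∏ v, chainMoebius (t v) (s v)

theorem zetaMatrix_mul_moveMatrix_mul_moebiusMatrix (g : SandConfig T → SandConfig T)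
    (s s' : SandConfig T) :
    (zetaMatrix T * moveMatrix g * moebiusMatrix T) s s' = downsetCoeff g s s' := by
  have h : ∀ t, (zetaMatrix T * moveMatrix g) s t = if ∀ w, g t w ≤ s w then 1 else 0 := by
    intro t
    simp [Matrix.mul_apply, zetaMatrix, moveMatrix]
  rw [Matrix.mul_apply, downsetCoeff]
  refine Finset.sum_congr rfl fun t _ => ?_
  rw [h, moebiusMatrix, Matrix.of_apply, ite_mul, one_mul, zero_mul]

theorem zetaMatrix_mul_moebiusMatrix : zetaMatrix T * moebiusMatrix T = 1 := by
  have h : moveMatrix (id : SandConfig T → SandConfig T) = 1 := by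
    ext t t'
    simp [moveMatrix, Matrix.one_apply, eq_comm]
  ext s s'
  have := zetaMatrix_mul_moveMatrix_mul_moebiusMatrix id s s'
  rw [h, mul_one, downsetCoeff_id] at this
  rw [this, Matrix.one_apply]
  simp only [eq_comm]

/-- There are `∏ v ∈ Sᶜ, T v` configurations that vanish exactly on `S`. -/
theorem card_filter_zeros (T : V → ℕ) (S : Finset V) :
    (Finset.univ.filter fun k : SandConfig T =>
      Finset.univ.filter (fun v => k v = 0) = S).card = ∏ v ∈ Sᶜ, T v := by
  have h : (Finset.univ.filter fun k : SandConfig T =>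
      Finset.univ.filter (fun v => k v = 0) = S) =
      Fintype.piFinset fun v => if v ∈ S then {0} else {0}ᶜ := by
    ext k
    simp only [Finset.mem_filter, Finset.mem_univ, true_and, Fintype.mem_piFinset,
      Finset.ext_iff]
    refine forall_congr' fun v => ?_
    by_cases hv : v ∈ S <;> simp [hv]
  rw [h, Fintype.card_piFinset, ← Finset.prod_mul_prod_compl S]
  rw [Finset.prod_eq_one fun v hv => by simp [hv], one_mul]
  refine Finset.prod_congr rfl fun v hv => ?_
  rw [if_neg (Finset.mem_compl.1 hv), Finset.card_compl]
  simp

end SandConfig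

namespace Arborescence

open SandConfig

variable {V : Type*} [Fintype V] [DecidableEq V] (A : Arborescence V)

/-- The landslide matrix in the basis of the indicator functions of down-sets. -/
theorem zetaMatrix_mul_landslideMatrix_mul_moebiusMatrix (T : V → ℕ) (x y : V → ℝ)
    (s s' : SandConfig T) :
    (zetaMatrix T * A.landslideMatrix T x y * moebiusMatrix T) s s' =
      ∑ v, x v * downsetCoeff (A.topple T v) s s' +
        ∑ l ∈ A.leaves, y l * downsetCoeff (A.source T l) s s' := by
  have h : A.landslideMatrix T x y =
      ∑ v, x v • moveMatrix (A.topple T v) + ∑ l ∈ A.leaves, y l • moveMatrix (A.source T l) := by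
    ext t' t
    simp [landslideMatrix, moveMatrix, Matrix.sum_apply]
  simp only [h, mul_add, add_mul, Finset.mul_sum, Finset.sum_mul, Matrix.add_apply,
    Matrix.sum_apply, mul_smul_comm, smul_mul_assoc, Matrix.smul_apply, smul_eq_mul,
    zetaMatrix_mul_moveMatrix_mul_moebiusMatrix]

/-- A matrix whose nonzero off-diagonal entries decrease the rank has the characteristic polynomial
of its diagonal: the rank vectors, ordered lexicographically with the vertices nearest to the root
first, make it triangular. -/
theorem charpoly_eq_prod_of_depthLT {T : V → ℕ} (N : Matrix (SandConfig T) (SandConfig T) ℝ)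
    (hN : ∀ s s', s' ≠ s → N s s' ≠ 0 → A.DepthLT (A.rank s') (A.rank s)) :
    N.charpoly = ∏ s, (X - C (N s s)) := by
  let _ : LinearOrder V := LinearOrder.lift'
    (fun v => toLex ((A.path v).length, Fintype.equivFin V v))
    fun v w h => (Fintype.equivFin V).injective (congrArg Prod.snd (toLex.injective h))
  have hlen : ∀ w u : V, w < u → (A.path w).length ≤ (A.path u).length := fun w u h =>
    (Prod.Lex.toLex_lt_toLex.1 h).elim le_of_lt fun h => h.1.le
  refine Matrix.BlockTriangular.charpoly_of_injective
    (b := fun s => OrderDual.toDual (toLex (A.rank s))) (fun s s' hlt => ?_)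
    (OrderDual.toDual.injective.comp (toLex.injective.comp A.rank_injective))
  by_contra h0
  refine lt_asymm (OrderDual.toDual_lt_toDual.1 hlt) ?_
  obtain ⟨u, hu, hw⟩ := hN s s' (by rintro rfl; exact lt_irrefl _ hlt) h0
  exact ⟨u, fun w hwu => hw w (hlen w u hwu) hwu.ne, hu⟩

theorem charpoly_landslideMatrix (T : V → ℕ) (x y : V → ℝ) :
    (A.landslideMatrix T x y).charpoly =
      ∏ S : Finset V, (X - C (A.leafSum y S) - C (∑ v ∈ S, x v)) ^ (∏ v ∈ Sᶜ, T v) := by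
  have hconj : (A.landslideMatrix T x y).charpoly =
      (zetaMatrix T * A.landslideMatrix T x y * moebiusMatrix T).charpoly := by
    have hinv : moebiusMatrix T * zetaMatrix T = 1 :=
      mul_eq_one_comm.1 zetaMatrix_mul_moebiusMatrix
    rw [Matrix.charpoly_mul_comm, ← mul_assoc, hinv, one_mul]
  rw [hconj, A.charpoly_eq_prod_of_depthLT]
  · have hdiag : ∀ s : SandConfig T,
        (X - C ((zetaMatrix T * A.landslideMatrix T x y * moebiusMatrix T) s s) : ℝ[X]) =
        (fun S : Finset V => X - C (A.leafSum y S) - C (∑ v ∈ S, x v))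
          (Finset.univ.filter fun v => A.rank s v = 0) := by
      intro s
      simp only [zetaMatrix_mul_landslideMatrix_mul_moebiusMatrix, downsetCoeff_topple_self,
        downsetCoeff_source_self, mul_ite, mul_one, mul_zero, leafSum, Finset.sum_filter]
      rw [C_add, sub_sub, add_comm]
    rw [Finset.prod_congr rfl fun s _ => hdiag s,
      (Finite.injective_iff_bijective.1 A.rank_injective).prod_comp fun k : SandConfig T =>
        (fun S : Finset V => (X - C (A.leafSum y S) - C (∑ v ∈ S, x v) : ℝ[X]))
          (Finset.univ.filter fun v => k v = 0),
      ← Finset.prod_fiberwise Finset.univ fun k : SandConfig T =>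
        Finset.univ.filter fun v => k v = 0]
    refine Finset.prod_congr rfl fun S _ => ?_
    rw [← card_filter_zeros T S]
    exact Finset.prod_eq_pow_card fun k hk => by rw [(Finset.mem_filter.1 hk).2]
  · intro s s' hne h0
    rw [zetaMatrix_mul_landslideMatrix_mul_moebiusMatrix] at h0
    by_contra hlt
    refine h0 ?_
    rw [Finset.sum_eq_zero, Finset.sum_eq_zero, add_zero]
    · intro l _
      rw [not_not.1 (mt (depthLT_of_downsetCoeff_source_ne_zero hne) hlt), mul_zero]
    · intro v _
      rw [not_not.1 (mt (depthLT_of_downsetCoeff_topple_ne_zero hne) hlt), mul_zero]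

end Arborescence

theorem mainTheorem1 {V : Type*} [Fintype V] [DecidableEq V] (A : Arborescence V) (T : V → ℕ)
    (x y : V → ℝ) (hx : ∀ v, 0 < x v) (hy : ∀ l ∈ A.leaves, 0 < y l)
    (hsum : ∑ v, x v + ∑ l ∈ A.leaves, y l = 1) :
    (A.landslideMatrix T x y).charpoly =
        ∏ S : Finset V, (X - C (A.leafSum y S) - C (∑ v ∈ S, x v)) ^ (∏ v ∈ Sᶜ, T v) ∧
      (∀ μ : ℂ,
        ((A.landslideMatrix T x y).map Complex.ofReal).charpoly.rootMultiplicity μ =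
          ∑ S : Finset V with ((A.leafSum y S + ∑ v ∈ S, x v : ℝ) : ℂ) = μ, ∏ v ∈ Sᶜ, T v) ∧
      ∀ μ : ℂ,
        Module.End.HasEigenvalue
            (Matrix.toLin' ((A.landslideMatrix T x y).map Complex.ofReal)) μ →
          ∃ S : Finset V, μ = ((A.leafSum y S + ∑ v ∈ S, x v : ℝ) : ℂ) := by
  have hchar := A.charpoly_landslideMatrix T x y
  have hcharC : ((A.landslideMatrix T x y).map Complex.ofReal).charpoly =
      ∏ S : Finset V, (X - C ((A.leafSum y S + ∑ v ∈ S, x v : ℝ) : ℂ)) ^ (∏ v ∈ Sᶜ, T v) := by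
    have := (A.landslideMatrix T x y).charpoly_map Complex.ofRealHom
    rw [hchar, Polynomial.map_prod] at this
    refine Eq.trans this (Finset.prod_congr rfl fun S _ => ?_)
    simp [sub_sub, Polynomial.map_sum]
  have hmult : ∀ μ : ℂ,
      ((A.landslideMatrix T x y).map Complex.ofReal).charpoly.rootMultiplicity μ =
        ∑ S : Finset V with ((A.leafSum y S + ∑ v ∈ S, x v : ℝ) : ℂ) = μ, ∏ v ∈ Sᶜ, T v := by
    intro μ
    have hne : ∏ S : Finset V,
        (X - C ((A.leafSum y S + ∑ v ∈ S, x v : ℝ) : ℂ)) ^ (∏ v ∈ Sᶜ, T v) ≠ 0 :=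
      Finset.prod_ne_zero_iff.2 fun S _ => pow_ne_zero _ (X_sub_C_ne_zero _)
    rw [hcharC, ← count_roots, roots_prod _ _ hne, Multiset.count_bind, Finset.sum_filter]
    refine Finset.sum_congr rfl fun S _ => ?_
    rw [roots_pow, roots_X_sub_C, Multiset.count_nsmul, Multiset.count_singleton]
    simp [eq_comm]
  refine ⟨hchar, hmult, fun μ hμ => ?_⟩
  have hroot := (Module.End.hasEigenvalue_iff_isRoot_charpoly _ _).1 hμ
  rw [Matrix.charpoly_toLin', hcharC, IsRoot.def, eval_prod, Finset.prod_eq_zero_iff] at hroot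
  obtain ⟨S, -, hS⟩ := hroot
  refine ⟨S, ?_⟩
  rw [eval_pow] at hS
  simpa [sub_eq_zero, eval_finsetSum] using eq_zero_of_pow_eq_zero hS
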